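/- A colouring of the vertices of a finite simple graph $G$ (not necessarily proper) is a conflict-free open-neighbourhood (CFON) colouring if for every vertex $v$ of $G$ there is a colour that appears exactly once on the open neighbourhood $N_G(v)$. The CFON chromatic number $\chi_{CF}^{ON}(G)$ is the minimum $r$ such that $G$ has a CFON colouring $c : V(G) \to \{1,\dots,r\}$. A graph is $K_{1,k}$-free if it does not contain the star $K_{1,k}$ as an induced subgraph. **Theorem.** There is an absolute constant $C > 0$ such that for every integer $k \ge 3$ and every finite $K_{1,k}$-free graph $G$ with no isolated vertices and maximum degree $\Delta \ge 2$, $$\chi_{CF}^{ON}(G) \le C\, k^2 \ln \Delta .$$ In other words, $\chi_{CF}^{ON}(G) = O(k^2 \ln \Delta)$. -/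

import Mathlib

namespace SimpleGraph

/-- A (not necessarily proper) vertex colouring `c` of `G` is a *conflict-free open neighbourhood*
(CFON) colouring if for every vertex `v` some colour appears exactly once in the open
neighbourhood of `v`. -/
def IsCFONColoring {V α : Type*} (G : SimpleGraph V) (c : V → α) : Prop :=
  ∀ v : V, ∃ a : α, ∃! u : V, u ∈ G.neighborSet v ∧ c u = a

/-- The CFON chromatic number: the least `r` such that `G` has a CFON colouring with colours in
`Fin r`. For a finite graph without isolated vertices such an `r` exists and the minimum is
attained, see `exists_isCFONColoring_cfonChromaticNumber`. -/
noncomputable def cfonChromaticNumber {V : Type*} (G : SimpleGraph V) : ℕ :=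
  sInf {r : ℕ | ∃ c : V → Fin r, G.IsCFONColoring c}

/-- On finite graphs without isolated vertices `cfonChromaticNumber` is a genuine minimum. -/
theorem exists_isCFONColoring_cfonChromaticNumber {V : Type*} [Finite V] (G : SimpleGraph V)
    (hG : ∀ v : V, ∃ u : V, G.Adj v u) :
    ∃ c : V → Fin G.cfonChromaticNumber, G.IsCFONColoring c := by
  have hne : {r : ℕ | ∃ c : V → Fin r, G.IsCFONColoring c}.Nonempty := by
    obtain ⟨n, ⟨e⟩⟩ := Finite.exists_equiv_fin V
    refine ⟨n, e, fun v => ?_⟩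
    obtain ⟨u, hu⟩ := hG v
    exact ⟨e u, u, ⟨hu, rfl⟩, fun w hw => e.injective hw.2⟩
  exact Nat.sInf_mem hne

end SimpleGraph

open Finset

/-! Peel off about log₂ Δ successive maximal independent sets, with union S. Each adds fewer than k
neighbours to any vertex and, by maximality, at least one to every vertex left outside S. Vertices
with a neighbour in S are served by O(k log Δ) colours on S. The others lie in S and form an
independent set T; a vertex has fewer than k neighbours in T, so k fresh colours off S serve T
greedily. This bound is linear in k.

Colouring S uses a counting induction in place of the local lemma: adding a vertex to X at most
halves the number of colourings conflict-free on X. In a bad edge every colour repeats, so half its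
vertices copy colours from the other half, which is costly when r is large compared with the edge
size. -/

/-- In a finite set on which every colour is repeated, at least half of the elements, including any
prescribed one, have a colour that also occurs on the remaining elements. -/
theorem exists_subset_card_eq_of_forall_repeated {V α : Type*} [DecidableEq V] [DecidableEq α]
    {e : Finset V} {c : V → α} {u : V} (hu : u ∈ e)
    (h : ∀ x ∈ e, ∃ y ∈ e, c y = c x ∧ y ≠ x) :
    ∃ Y ⊆ e, u ∈ Y ∧ #Y = (#e + 1) / 2 ∧ ∀ y ∈ Y, ∃ z ∈ e \ Y, c z = c y := by
  have hrep : ∀ a ∈ e.image c, ∃ z ∈ e, c z = a ∧ z ≠ u := by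
    intro a ha
    obtain ⟨x, hx, rfl⟩ := mem_image.1 ha
    by_cases hxu : x = u
    · obtain ⟨y, hy, hyx, hne⟩ := h x hx
      exact ⟨y, hy, hyx, hxu ▸ hne⟩
    · exact ⟨x, hx, rfl, hxu⟩
  have : Nonempty V := ⟨u⟩
  choose! p hpe hpc hpu using hrep
  -- R keeps one representative other than u per colour. Colours occur at least twice, so R is at
  -- most half of e and leaves room for Y.
  set R := (e.image c).image p with hR
  have hRe : R ⊆ e := by
    intro x hx
    obtain ⟨a, ha, rfl⟩ := mem_image.1 hx
    exact hpe a ha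
  have hcard : 2 * #(e.image c) ≤ #e := by
    refine mul_card_image_le_card (s := e) (f := c) 2 ?_
    intro a ha
    obtain ⟨x, hx, rfl⟩ := mem_image.1 ha
    obtain ⟨y, hy, hyx, hne⟩ := h x hx
    exact one_lt_card.2 ⟨y, by simp [hy, hyx], x, by simp [hx], hne⟩
  have hRc : #R ≤ #(e.image c) := card_image_le
  have huR : u ∉ R := by
    intro hx
    obtain ⟨a, ha, hau⟩ := mem_image.1 hx
    exact hpu a ha hau
  have hsd : #(e \ R) = #e - #R := card_sdiff_of_subset hRe
  have hpos : 0 < #e := card_pos.2 ⟨u, hu⟩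
  obtain ⟨Y, huY, hY, hYc⟩ := exists_subsuperset_card_eq (s := {u}) (t := e \ R)
    (n := (#e + 1) / 2) (by simp [hu, huR]) (by simp; omega) (by omega)
  refine ⟨Y, hY.trans sdiff_subset, huY (mem_singleton_self u), hYc, fun y hy => ?_⟩
  have hye : y ∈ e := (mem_sdiff.1 (hY hy)).1
  have him : c y ∈ e.image c := mem_image_of_mem c hye
  refine ⟨p (c y), mem_sdiff.2 ⟨hpe _ him, fun hmem => ?_⟩, hpc _ him⟩
  exact (mem_sdiff.1 (hY hmem)).2 (mem_image_of_mem p him)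

/-! ### Conflict-free colourings of hypergraphs -/

section Counting

variable {V ι : Type*} [Fintype V] [Fintype ι]

open Classical in
/-- The colourings with `r` colours for which every nonempty edge contained in `X` has a uniquely
coloured vertex. -/
noncomputable def conflictFreeOn (e : ι → Finset V) (r : ℕ) (X : Finset V) :
    Finset (V → Fin r) :=
  {c | ∀ i, (e i).Nonempty → e i ⊆ X → ∃ x ∈ e i, ∀ y ∈ e i, c y = c x → y = x}

theorem mem_conflictFreeOn {e : ι → Finset V} {r : ℕ} {X : Finset V} {c : V → Fin r} :
    c ∈ conflictFreeOn e r X ↔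
      ∀ i, (e i).Nonempty → e i ⊆ X → ∃ x ∈ e i, ∀ y ∈ e i, c y = c x → y = x := by
  simp [conflictFreeOn]

theorem conflictFreeOn_anti (e : ι → Finset V) (r : ℕ) {X Y : Finset V} (h : X ⊆ Y) :
    conflictFreeOn e r Y ⊆ conflictFreeOn e r X := fun _ hc =>
  mem_conflictFreeOn.2 fun i hi hX => mem_conflictFreeOn.1 hc i hi (hX.trans h)

open Classical in
/-- Colourings in which the colours on `Y` are copied from vertices outside `Y` are rare. -/
theorem card_copied_mul_pow_le (e : ι → Finset V) (r : ℕ) (X Y : Finset V) (g : Y → V) :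
    #{c ∈ conflictFreeOn e r (X \ Y) | ∀ y : Y, g y ∉ Y ∧ c (g y) = c y} * r ^ #Y ≤
      #(conflictFreeOn e r (X \ Y)) := by
  have hfun : #(univ : Finset (Y → Fin r)) = r ^ #Y := by simp
  rw [← hfun, ← card_product]
  -- Recolour Y arbitrarily. The old colours on Y can be read off outside Y through g, so nothing is
  -- lost.
  refine card_le_card_of_injOn
    (fun q : (V → Fin r) × (Y → Fin r) => fun v => if h : v ∈ Y then q.2 ⟨v, h⟩ else q.1 v) ?_ ?_
  · rintro ⟨c, h⟩ hq
    simp only [coe_product, Set.mem_prod, mem_coe, mem_filter] at hq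
    refine mem_conflictFreeOn.2 fun i hi hX => ?_
    have hout : ∀ y ∈ e i, y ∉ Y := fun y hy => (mem_sdiff.1 (hX hy)).2
    obtain ⟨x, hx, hxu⟩ := mem_conflictFreeOn.1 hq.1.1 i hi hX
    refine ⟨x, hx, fun y hy hyx => hxu y hy ?_⟩
    simpa [hout y hy, hout x hx] using hyx
  · rintro ⟨c, h⟩ hq ⟨c', h'⟩ hq' heq
    simp only [coe_product, Set.mem_prod, mem_coe, mem_filter] at hq hq'
    have hc : ∀ v ∉ Y, c v = c' v := fun v hv => by simpa [hv] using congrFun heq v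
    ext1
    · funext v
      by_cases hv : v ∈ Y
      · have h1 := hq.1.2 ⟨v, hv⟩
        have h2 := hq'.1.2 ⟨v, hv⟩
        exact h1.2.symm.trans ((hc _ h1.1).trans h2.2)
      · exact hc v hv
    · funext y
      simpa using congrFun heq y

open Classical in
/-- If passing from `X'` to `insert u X'` at most halves the number of conflict-free colourings for
all `X'` smaller than `X`, then removing `Z` from `X` gains a factor of at most `2 ^ #Z`. -/
theorem card_conflictFreeOn_sdiff_le (e : ι → Finset V) (r : ℕ) (X : Finset V)
    (ih : ∀ X' : Finset V, #X' < #X → ∀ u ∉ X',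
      #(conflictFreeOn e r X') ≤ 2 * #(conflictFreeOn e r (insert u X')))
    (Z : Finset V) (hZ : Z ⊆ X) :
    #(conflictFreeOn e r (X \ Z)) ≤ 2 ^ #Z * #(conflictFreeOn e r X) := by
  induction Z using Finset.induction_on with
  | empty => simp
  | insert z Z hz ihZ =>
    have hzX : z ∈ X := hZ (mem_insert_self z Z)
    have hins : insert z (X \ insert z Z) = X \ Z := by
      ext v
      by_cases hv : v = z <;> simp [hv, hzX, hz]
    have hlt : #(X \ insert z Z) < #X :=
      card_lt_card ⟨sdiff_subset, fun h => by simpa using h hzX⟩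
    have h1 := ih _ hlt z (by simp)
    rw [hins] at h1
    have h2 := ihZ ((subset_insert z Z).trans hZ)
    rw [card_insert_of_notMem hz, pow_succ]
    nlinarith

open Classical in
/-- The number of colourings, conflict-free on `X`, that fail on a given edge through `u`. -/
theorem card_filter_repeated_mul_pow_le (e : ι → Finset V) (r : ℕ) (X : Finset V) {u : V}
    (huX : u ∉ X)
    (ih : ∀ X' : Finset V, #X' < #X → ∀ u ∉ X',
      #(conflictFreeOn e r X') ≤ 2 * #(conflictFreeOn e r (insert u X')))
    (E : Finset V) (huE : u ∈ E) (hE : E ⊆ insert u X) :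
    2 * #{c ∈ conflictFreeOn e r X | ∀ x ∈ E, ∃ y ∈ E, c y = c x ∧ y ≠ x} * r ^ ((#E + 1) / 2) ≤
      2 ^ #E * (2 * #E) ^ ((#E + 1) / 2) * #(conflictFreeOn e r X) := by
  set t := (#E + 1) / 2 with ht
  set N := #(conflictFreeOn e r X) with hN
  set B : (Y : Finset V) → (Y → E) → Finset (V → Fin r) := fun Y g =>
    {c ∈ conflictFreeOn e r (insert u X \ Y) |
      ∀ y : Y, (g y : V) ∉ Y ∧ c (g y) = c y} with hB
  set P := {Y ∈ E.powersetCard t | u ∈ Y} with hP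
  have hsub : {c ∈ conflictFreeOn e r X | ∀ x ∈ E, ∃ y ∈ E, c y = c x ∧ y ≠ x} ⊆
      P.biUnion fun Y => univ.biUnion fun g => B Y g := by
    intro c hc
    rw [mem_filter] at hc
    obtain ⟨Y, hYE, huY, hYc, hY⟩ := exists_subset_card_eq_of_forall_repeated huE hc.2
    choose g hg hgc using hY
    simp only [mem_biUnion, hP, mem_filter, mem_powersetCard, hB]
    refine ⟨Y, ⟨⟨hYE, hYc⟩, huY⟩, fun y => ⟨g y y.2, (mem_sdiff.1 (hg y y.2)).1⟩, mem_univ _,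
      conflictFreeOn_anti e r ?_ hc.1, fun y => ⟨(mem_sdiff.1 (hg y y.2)).2, hgc y y.2⟩⟩
    intro v hv
    simp only [mem_sdiff, mem_insert] at hv
    rcases hv.1 with rfl | h
    · exact absurd huY hv.2
    · exact h
  have hBle : ∀ Y ∈ P, ∀ g : Y → E, 2 * (#(B Y g) * r ^ t) ≤ 2 ^ t * N := by
    intro Y hY g
    simp only [hP, mem_filter, mem_powersetCard] at hY
    obtain ⟨⟨hYE, hYc⟩, huY⟩ := hY
    have h1 := card_copied_mul_pow_le e r (insert u X) Y (fun y => (g y : V))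
    have h2 : insert u X \ Y = X \ Y.erase u := by
      ext v
      by_cases hv : v = u
      · simp [hv, huY, huX]
      · simp [hv]
    have h3 := card_conflictFreeOn_sdiff_le e r X ih (Y.erase u) (by
      intro v hv
      rw [mem_erase] at hv
      exact (mem_insert.1 (hE (hYE hv.2))).resolve_left hv.1)
    rw [hYc] at h1
    have h4 : #Y = #(Y.erase u) + 1 := (card_erase_add_one huY).symm
    have h5 : 2 ^ t = 2 * 2 ^ #(Y.erase u) := by rw [← hYc, h4, pow_succ]; ring
    rw [h5, mul_assoc]
    refine Nat.mul_le_mul_left 2 (h1.trans ?_)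
    rw [h2]
    exact h3
  have hPc : #P ≤ 2 ^ #E := by
    rw [← card_powerset]
    refine card_le_card fun Y hY => mem_powerset.2 ?_
    exact (mem_powersetCard.1 (mem_filter.1 hY).1).1
  have hgc : ∀ Y ∈ P, #(univ : Finset (Y → E)) = #E ^ t := by
    intro Y hY
    have : #Y = t := (mem_powersetCard.1 (mem_filter.1 hY).1).2
    simp [this]
  calc _ ≤ 2 * (∑ Y ∈ P, ∑ g : Y → E, #(B Y g)) * r ^ t := by
        gcongr
        exact (card_le_card hsub).trans
          (card_biUnion_le.trans (sum_le_sum fun Y _ => card_biUnion_le))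
    _ = ∑ Y ∈ P, ∑ g : Y → E, 2 * (#(B Y g) * r ^ t) := by
        simp only [mul_assoc, ← mul_sum, ← sum_mul]
    _ ≤ ∑ Y ∈ P, ∑ g : Y → E, 2 ^ t * N :=
        sum_le_sum fun Y hY => sum_le_sum fun g _ => hBle Y hY g
    _ = ∑ Y ∈ P, #E ^ t * (2 ^ t * N) := by
        refine sum_congr rfl fun Y hY => ?_
        rw [sum_const, hgc Y hY, smul_eq_mul]
    _ = #P * (#E ^ t * (2 ^ t * N)) := by rw [sum_const, smul_eq_mul]
    _ ≤ 2 ^ #E * (#E ^ t * (2 ^ t * N)) := by gcongr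
    _ = _ := by rw [mul_pow]; ring

open Classical in
/-- A local criterion for conflict-free colourings of hypergraphs: if around every vertex the edges
`E` have total weight `∑ 2 ^ |E| (2 |E| / r) ^ ⌈|E| / 2⌉` at most one, then some colouring with `r`
colours has a uniquely coloured vertex in every nonempty edge. -/
theorem exists_conflictFree_of_sum_weight_le_one (e : ι → Finset V) {r : ℕ} (hr : 0 < r)
    (hw : ∀ u, ∑ i with u ∈ e i,
      (2 ^ #(e i) * (2 * #(e i)) ^ ((#(e i) + 1) / 2) / r ^ ((#(e i) + 1) / 2) : ℝ) ≤ 1) :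
    ∃ c : V → Fin r, ∀ i, (e i).Nonempty → ∃ x ∈ e i, ∀ y ∈ e i, c y = c x → y = x := by
  have step : ∀ n, ∀ X : Finset V, #X = n → ∀ u ∉ X,
      #(conflictFreeOn e r X) ≤ 2 * #(conflictFreeOn e r (insert u X)) := by
    intro n
    induction n using Nat.strong_induction_on with
    | _ n ihn =>
    intro X hX u huX
    have ih : ∀ X' : Finset V, #X' < #X → ∀ u ∉ X',
        #(conflictFreeOn e r X') ≤ 2 * #(conflictFreeOn e r (insert u X')) :=
      fun X' hX' => ihn _ (hX ▸ hX') X' rfl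
    set bad : ι → Finset (V → Fin r) := fun i =>
      {c ∈ conflictFreeOn e r X | ∀ x ∈ e i, ∃ y ∈ e i, c y = c x ∧ y ≠ x} with hbad
    set I : Finset ι := {i | u ∈ e i ∧ e i ⊆ insert u X} with hI
    have hsub : conflictFreeOn e r X ⊆ conflictFreeOn e r (insert u X) ∪ I.biUnion bad := by
      intro c hc
      by_contra hcon
      rw [mem_union, not_or] at hcon
      refine hcon.1 (mem_conflictFreeOn.2 fun i hi hiX => ?_)
      by_cases hui : u ∈ e i
      · by_contra! hno
        refine hcon.2 (mem_biUnion.2 ⟨i, by simp [hI, hui, hiX], ?_⟩)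
        exact mem_filter.2 ⟨hc, hno⟩
      · exact mem_conflictFreeOn.1 hc i hi ((subset_insert_iff_of_notMem hui).1 hiX)
    have hle : (#(conflictFreeOn e r X) : ℝ) ≤
        #(conflictFreeOn e r (insert u X)) + ∑ i ∈ I, (#(bad i) : ℝ) := by
      exact_mod_cast (card_le_card hsub).trans
        ((card_union_le _ _).trans (Nat.add_le_add_left card_biUnion_le _))
    have hr' : (0 : ℝ) < r := by exact_mod_cast hr
    have hbadle : ∀ i ∈ I, 2 * (#(bad i) : ℝ) ≤
        (2 ^ #(e i) * (2 * #(e i)) ^ ((#(e i) + 1) / 2) / r ^ ((#(e i) + 1) / 2)) *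
          #(conflictFreeOn e r X) := by
      intro i hi
      simp only [hI, mem_filter, mem_univ, true_and] at hi
      have h := card_filter_repeated_mul_pow_le e r X huX ih (e i) hi.1 hi.2
      rw [div_mul_eq_mul_div, le_div_iff₀ (by positivity)]
      exact_mod_cast h
    have hsum : 2 * ∑ i ∈ I, (#(bad i) : ℝ) ≤ 1 * #(conflictFreeOn e r X) := by
      rw [mul_sum]
      refine (sum_le_sum hbadle).trans ?_
      rw [← sum_mul]
      refine mul_le_mul_of_nonneg_right (le_trans ?_ (hw u)) (by positivity)
      refine sum_le_sum_of_subset_of_nonneg (fun i hi => ?_) fun _ _ _ => by positivity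
      simp only [hI, mem_filter, mem_univ, true_and] at hi ⊢
      exact hi.1
    have : (#(conflictFreeOn e r X) : ℝ) ≤ 2 * #(conflictFreeOn e r (insert u X)) := by linarith
    exact_mod_cast this
  have hpos : ∀ X : Finset V, 0 < #(conflictFreeOn e r X) := by
    intro X
    induction X using Finset.induction_on with
    | empty =>
      refine card_pos.2 ⟨fun _ => ⟨0, hr⟩, mem_conflictFreeOn.2 fun i hi hie => ?_⟩
      exact absurd (subset_empty.1 hie) hi.ne_empty
    | insert u X hu ih =>
      have := step _ X rfl u hu
      omega
  obtain ⟨c, hc⟩ := card_pos.1 (hpos univ)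
  exact ⟨c, fun i hi => mem_conflictFreeOn.1 hc i hi (subset_univ _)⟩

open Classical in
/-- A finite hypergraph in which every vertex lies in at most `d` edges has a conflict-free
colouring with `d + 1` colours. -/
theorem exists_conflictFree_of_degree_le (e : ι → Finset V) {d : ℕ}
    (hd : ∀ u, #{i | u ∈ e i} ≤ d) :
    ∃ c : V → Fin (d + 1), ∀ i, (e i).Nonempty → ∃ x ∈ e i, ∀ y ∈ e i, c y = c x → y = x := by
  suffices h : ∀ X : Finset V, ∃ c : V → Fin (d + 1), ∀ i, (e i ∩ X).Nonempty →
      ∃ x ∈ e i ∩ X, ∀ y ∈ e i ∩ X, c y = c x → y = x by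
    simpa using h univ
  intro X
  induction X using Finset.induction_on with
  | empty => simp
  | insert u X hu ih =>
    obtain ⟨c, hc⟩ := ih
    have : Nonempty V := ⟨u⟩
    choose! p hp hpu using hc
    -- Give u a colour avoiding the unique colours already chosen for the at most d edges through u.
    obtain ⟨a, ha⟩ : ∃ a, a ∉ ({i | u ∈ e i} : Finset ι).image fun i => c (p i) := by
      by_contra! hall
      have h1 := card_le_card (fun a _ => hall a : (univ : Finset (Fin (d + 1))) ⊆ _)
      have h2 := h1.trans (card_image_le.trans (hd u))
      simp at h2
    have ha' : ∀ i, u ∈ e i → c (p i) ≠ a := fun i hi hia =>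
      ha (mem_image.2 ⟨i, by simpa using hi, hia⟩)
    have hupd : ∀ v ∈ X, Function.update c u a v = c v := fun v hv =>
      Function.update_of_ne (ne_of_mem_of_not_mem hv hu) _ _
    refine ⟨Function.update c u a, fun i hi => ?_⟩
    by_cases hX : (e i ∩ X).Nonempty
    · have hpi := mem_inter.1 (hp i hX)
      refine ⟨p i, mem_inter.2 ⟨hpi.1, mem_insert_of_mem hpi.2⟩, fun y hy hyp => ?_⟩
      rw [mem_inter, mem_insert] at hy
      rw [hupd _ hpi.2] at hyp
      rcases hy.2 with rfl | hyX
      · rw [Function.update_self] at hyp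
        exact absurd hyp.symm (ha' i hy.1)
      · rw [hupd _ hyX] at hyp
        exact hpu i hX y (mem_inter.2 ⟨hy.1, hyX⟩) hyp
    · have honly : ∀ y ∈ e i ∩ insert u X, y = u := by
        intro y hy
        rw [mem_inter, mem_insert] at hy
        exact hy.2.resolve_right fun h => hX ⟨y, mem_inter.2 ⟨hy.1, h⟩⟩
      obtain ⟨x, hx⟩ := hi
      exact ⟨x, hx, fun y hy _ => (honly y hy).trans (honly x hx).symm⟩

end Counting
-- Independent sets in star-free graphs
namespace SimpleGraph

variable {V : Type*} {G : SimpleGraph V} {k : ℕ}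

open Classical in
/-- In a graph without induced `K_{1,k}`, fewer than `k` vertices of an independent set are adjacent
to a given vertex. -/
theorem card_filter_adj_lt_of_isIndepSet
    (h : ¬ (completeBipartiteGraph (Fin 1) (Fin k)).IsIndContained G) {I : Finset V}
    (hI : G.IsIndepSet I) (v : V) : #{u ∈ I | G.Adj v u} < k := by
  by_contra! hk
  obtain ⟨J, hJ, hJc⟩ := exists_subset_card_eq hk
  let f : Fin k ≃ J := (J.equivFinOfCardEq hJc).symm
  have hJv : ∀ x : J, G.Adj v x := fun x => (mem_filter.1 (hJ x.2)).2
  have hJI : ∀ x y : J, ¬ G.Adj x y := fun x y hxy =>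
    hI (mem_filter.1 (hJ x.2)).1 (mem_filter.1 (hJ y.2)).1 hxy.ne hxy
  refine h ⟨⟨⟨Sum.elim (fun _ => v) fun i => (f i : V), ?_⟩, ?_⟩⟩
  · rintro (i | i) (j | j) hij
    · rw [Subsingleton.elim i j]
    · exact absurd hij (hJv _).ne
    · exact absurd hij (hJv _).ne'
    · exact congrArg Sum.inr (f.injective (Subtype.ext hij))
  · rintro (i | i) (j | j)
    · change G.Adj v v ↔ _
      simp
    · change G.Adj v (f j) ↔ _
      simpa using hJv (f j)
    · change G.Adj (f i) v ↔ _
      simpa using (hJv (f i)).symm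
    · change G.Adj (f i) (f j) ↔ _
      simpa using hJI (f i) (f j)

open Classical in
theorem exists_maximal_isIndepSet_subset (G : SimpleGraph V) (U : Finset V) :
    ∃ I ⊆ U, G.IsIndepSet (I : Set V) ∧ ∀ v ∈ U, v ∉ I → ∃ w ∈ I, G.Adj v w := by
  obtain ⟨I, hI⟩ := ({I ∈ U.powerset | G.IsIndepSet (I : Set V)} : Finset (Finset V)).exists_maximal
    ⟨∅, by simp [IsIndepSet]⟩
  have hIm := mem_filter.1 hI.prop
  refine ⟨I, mem_powerset.1 hIm.1, hIm.2, fun v hvU hvI => ?_⟩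
  by_contra! hno
  refine hvI (hI.le_of_ge (y := insert v I) ?_ (subset_insert v I) (mem_insert_self v I))
  refine mem_filter.2 ⟨mem_powerset.2 (insert_subset hvU (mem_powerset.1 hIm.1)), ?_⟩
  rw [coe_insert]
  exact hIm.2.insert fun w hw _ => ⟨hno w hw, fun hwv => hno w hw hwv.symm⟩

open Classical in
/-- Peeling off `m` maximal independent sets from a graph without induced `K_{1,k + 1}`. -/
theorem exists_card_filter_adj_le_and_ge [Fintype V]
    (h : ¬ (completeBipartiteGraph (Fin 1) (Fin (k + 1))).IsIndContained G) (m : ℕ) :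
    ∃ S : Finset V, (∀ v, #{u ∈ S | G.Adj v u} ≤ k * m) ∧
      ∀ v ∉ S, m ≤ #{u ∈ S | G.Adj v u} := by
  induction m with
  | zero => exact ⟨∅, by simp, by simp⟩
  | succ m ih =>
    obtain ⟨S, hle, hge⟩ := ih
    obtain ⟨I, hIS, hI, hmax⟩ := G.exists_maximal_isIndepSet_subset Sᶜ
    have hdisj : Disjoint S I :=
      Finset.disjoint_left.2 fun x hx hxI => mem_compl.1 (hIS hxI) hx
    have hcard : ∀ v, #{u ∈ S ∪ I | G.Adj v u} =
        #{u ∈ S | G.Adj v u} + #{u ∈ I | G.Adj v u} := fun v => by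
      rw [filter_union, card_union_of_disjoint (disjoint_filter_filter hdisj)]
    refine ⟨S ∪ I, fun v => ?_, fun v hv => ?_⟩
    · have h1 := card_filter_adj_lt_of_isIndepSet h hI v
      have h2 := hle v
      rw [hcard, mul_add_one]
      omega
    · rw [mem_union, not_or] at hv
      obtain ⟨w, hw, hvw⟩ := hmax v (mem_compl.2 hv.1) hv.2
      have h1 : 0 < #{u ∈ I | G.Adj v u} := card_pos.2 ⟨w, mem_filter.2 ⟨hw, hvw⟩⟩
      have h2 := hge v hv.1
      rw [hcard]
      omega

/-! ### Edge weights and the colouring of S -/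

theorem weight_le_pow {s D : ℕ} (hs : 0 < s) (hsD : s ≤ D) :
    (2 ^ s * (2 * s) ^ ((s + 1) / 2) / ((64 * D : ℕ) : ℝ) ^ ((s + 1) / 2) : ℝ) ≤
      (s / (8 * D)) ^ ((s + 1) / 2) := by
  set t := (s + 1) / 2 with ht
  have hD : (0 : ℝ) < D := by exact_mod_cast hs.trans_le hsD
  have h2 : (2 : ℝ) ^ s ≤ 4 ^ t := by
    rw [show (4 : ℝ) = 2 ^ 2 by norm_num, ← pow_mul]
    exact pow_le_pow_right₀ (by norm_num) (by omega)
  calc (2 ^ s * (2 * s) ^ t / ((64 * D : ℕ) : ℝ) ^ t : ℝ)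
      ≤ 4 ^ t * (2 * s) ^ t / ((64 * D : ℕ) : ℝ) ^ t := by gcongr
    _ = (s / (8 * D)) ^ t := by
      rw [← mul_pow, ← div_pow]
      congr 1
      push_cast
      field_simp
      norm_num

/-- For edges of vertices in S, which may be small but of which at most D pass through a given
vertex. -/
theorem weight_le_inv_mul {s D : ℕ} (hs : 0 < s) (hsD : s ≤ D) :
    (2 ^ s * (2 * s) ^ ((s + 1) / 2) / ((64 * D : ℕ) : ℝ) ^ ((s + 1) / 2) : ℝ) ≤ 1 / (4 * D) := by
  refine (weight_le_pow hs hsD).trans ?_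
  obtain ⟨t, ht⟩ : ∃ t, (s + 1) / 2 = t + 1 := ⟨(s + 1) / 2 - 1, by omega⟩
  have hD : (0 : ℝ) < D := by exact_mod_cast hs.trans_le hsD
  have hs2 : (s : ℝ) ≤ 2 * (t + 1) := by exact_mod_cast (by omega : s ≤ 2 * (t + 1))
  have hsD' : (s : ℝ) ≤ D := by exact_mod_cast hsD
  have h8 : (s / (8 * D) : ℝ) ≤ 1 / 8 := by
    rw [div_le_div_iff₀ (by positivity) (by norm_num)]
    linarith
  have hb : ((t : ℝ) + 1) * (1 / 8) ^ t ≤ 1 := by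
    have h1 : (t : ℝ) + 1 ≤ 8 ^ t := by
      exact_mod_cast Nat.lt_pow_self (n := t) (by norm_num : 1 < 8)
    calc ((t : ℝ) + 1) * (1 / 8) ^ t ≤ 8 ^ t * (1 / 8) ^ t := by gcongr
      _ = 1 := by rw [← mul_pow]; norm_num
  rw [ht, pow_succ]
  calc ((s / (8 * D)) ^ t * (s / (8 * D)) : ℝ)
      ≤ (1 / 8) ^ t * (2 * (t + 1) / (8 * D)) := by gcongr
    _ = ((t + 1) * (1 / 8) ^ t) * (1 / (4 * D)) := by field_simp; norm_num
    _ ≤ 1 * (1 / (4 * D)) := by gcongr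
    _ = 1 / (4 * D) := one_mul _

/-- For edges of vertices outside S: up to Δ through a given vertex, but of size at least m. -/
theorem weight_le_inv_two_pow {s D : ℕ} (hs : 0 < s) (hsD : s ≤ D) :
    (2 ^ s * (2 * s) ^ ((s + 1) / 2) / ((64 * D : ℕ) : ℝ) ^ ((s + 1) / 2) : ℝ) ≤ (1 / 2) ^ s := by
  refine (weight_le_pow hs hsD).trans ?_
  have hD : (0 : ℝ) < D := by exact_mod_cast hs.trans_le hsD
  have hsD' : (s : ℝ) ≤ D := by exact_mod_cast hsD
  have h4 : (s / (8 * D) : ℝ) ≤ (1 / 2) ^ 2 := by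
    rw [div_le_iff₀ (by positivity)]
    linarith
  calc ((s / (8 * D)) ^ ((s + 1) / 2) : ℝ)
      ≤ ((1 / 2) ^ 2) ^ ((s + 1) / 2) := by gcongr
    _ = (1 / 2) ^ (2 * ((s + 1) / 2)) := by rw [← pow_mul]
    _ ≤ (1 / 2) ^ s := pow_le_pow_of_le_one (by norm_num) (by norm_num) (by omega)

open Classical in
/-- If every vertex has at most `D` neighbours in `S`, and every vertex outside `S` has at least
`m` of them, where `2 ^ m` is at least twice the maximum degree, then `64 * D` colours suffice for
all vertices with a neighbour in `S` to have a uniquely coloured neighbour in `S`. -/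
theorem exists_conflictFree_neighbors_inter [Fintype V] [DecidableRel G.Adj] {S : Finset V} {D m : ℕ}
    (hD : 0 < D) (hΔ : 0 < G.maxDegree) (hm : 2 * G.maxDegree ≤ 2 ^ m)
    (hle : ∀ v, #{u ∈ S | G.Adj v u} ≤ D) (hge : ∀ v ∉ S, m ≤ #{u ∈ S | G.Adj v u}) :
    ∃ c : V → Fin (64 * D), ∀ v, (∃ u ∈ S, G.Adj v u) →
      ∃ x ∈ S, G.Adj v x ∧ ∀ y ∈ S, G.Adj v y → c y = c x → y = x := by
  set E : V → Finset V := fun v => {u ∈ S | G.Adj v u} with hE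
  suffices hw : ∀ u, ∑ v with u ∈ E v, (2 ^ #(E v) * (2 * #(E v)) ^ ((#(E v) + 1) / 2) /
      ((64 * D : ℕ) : ℝ) ^ ((#(E v) + 1) / 2) : ℝ) ≤ 1 by
    obtain ⟨c, hc⟩ := exists_conflictFree_of_sum_weight_le_one E (by omega) hw
    refine ⟨c, fun v ⟨u, hu, hvu⟩ => ?_⟩
    obtain ⟨x, hx, hxu⟩ := hc v ⟨u, mem_filter.2 ⟨hu, hvu⟩⟩
    rw [mem_filter] at hx
    exact ⟨x, hx.1, hx.2, fun y hy hvy => hxu y (mem_filter.2 ⟨hy, hvy⟩)⟩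
  intro u
  have hD' : (0 : ℝ) < D := by exact_mod_cast hD
  have hΔ' : (0 : ℝ) < G.maxDegree := by exact_mod_cast hΔ
  have hpos : ∀ v, u ∈ E v → 0 < #(E v) := fun v hv => card_pos.2 ⟨u, hv⟩
  rw [← sum_filter_add_sum_filter_not _ (· ∈ S)]
  have hin : ∑ v ∈ ({v | u ∈ E v} : Finset V) with v ∈ S,
      (2 ^ #(E v) * (2 * #(E v)) ^ ((#(E v) + 1) / 2) /
        ((64 * D : ℕ) : ℝ) ^ ((#(E v) + 1) / 2) : ℝ) ≤ D * (1 / (4 * D)) := by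
    refine (sum_le_card_nsmul _ _ (1 / (4 * D) : ℝ) fun v hv => ?_).trans ?_
    · simp only [mem_filter, mem_univ, true_and] at hv
      exact weight_le_inv_mul (hpos v hv.1) (hle v)
    · rw [nsmul_eq_mul]
      gcongr
      refine (card_le_card fun v hv => ?_).trans (hle u)
      simp only [hE, mem_filter, mem_univ, true_and] at hv ⊢
      exact ⟨hv.2, hv.1.2.symm⟩
  have hout : ∑ v ∈ ({v | u ∈ E v} : Finset V) with v ∉ S,
      (2 ^ #(E v) * (2 * #(E v)) ^ ((#(E v) + 1) / 2) /
        ((64 * D : ℕ) : ℝ) ^ ((#(E v) + 1) / 2) : ℝ) ≤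
      G.maxDegree * (1 / (2 * G.maxDegree)) := by
    refine (sum_le_card_nsmul _ _ (1 / (2 * G.maxDegree) : ℝ) fun v hv => ?_).trans ?_
    · simp only [mem_filter, mem_univ, true_and] at hv
      refine (weight_le_inv_two_pow (hpos v hv.1) (hle v)).trans ?_
      refine (pow_le_pow_of_le_one (by norm_num) (by norm_num) (hge v hv.2)).trans ?_
      rw [one_div_pow]
      exact one_div_le_one_div_of_le (by positivity) (by exact_mod_cast hm)
    · rw [nsmul_eq_mul]
      gcongr
      refine le_trans ?_ (G.degree_le_maxDegree u)
      rw [← card_neighborFinset_eq_degree]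
      refine card_le_card fun v hv => ?_
      simp only [hE, mem_filter, mem_univ, true_and] at hv
      exact (mem_neighborFinset _ _ _).2 hv.1.2.symm
  have h1 : (D : ℝ) * (1 / (4 * D)) = 1 / 4 := by field_simp
  have h2 : (G.maxDegree : ℝ) * (1 / (2 * G.maxDegree)) = 1 / 2 := by field_simp
  linarith

/-- A graph without induced `K_{1,k + 1}` and without isolated vertices has a CFON colouring with
`64 * (k * m) + (k + 1)` colours whenever `2 ^ m` is at least twice its maximum degree. -/
theorem cfonChromaticNumber_le [Fintype V] [DecidableRel G.Adj] {m : ℕ} (hk : 0 < k)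
    (h : ¬ (completeBipartiteGraph (Fin 1) (Fin (k + 1))).IsIndContained G)
    (hG : ∀ v, ∃ u, G.Adj v u) (hΔ : 0 < G.maxDegree) (hm : 2 * G.maxDegree ≤ 2 ^ m) :
    G.cfonChromaticNumber ≤ 64 * (k * m) + (k + 1) := by
  classical
  have hm0 : 0 < m := by
    rcases Nat.eq_zero_or_pos m with rfl | h0
    · simp at hm
      omega
    · exact h0
  obtain ⟨S, hle, hge⟩ := exists_card_filter_adj_le_and_ge h m
  have hge : ∀ v ∉ S, m ≤ #{u ∈ S | G.Adj v u} := fun v hv => by convert hge v hv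
  obtain ⟨c, hc⟩ := exists_conflictFree_neighbors_inter (Nat.mul_pos hk hm0) hΔ hm
    (fun v => (card_le_card fun u hu => by simpa using hu).trans (hle v))
    (fun v hv => (hge v hv).trans (card_le_card fun u hu => by simpa using hu))
  -- T contains every vertex without a neighbour in S, because 0 < m gives vertices outside S such a
  -- neighbour.
  set T : Finset V := {v ∈ S | ∀ u ∈ S, ¬ G.Adj v u} with hT
  have hTI : G.IsIndepSet (T : Set V) := by
    intro v hv w hw _
    simp only [hT, coe_filter, Set.mem_ofPred_eq] at hv hw
    exact hv.2 w hw.1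
  obtain ⟨d, hd⟩ := exists_conflictFree_of_degree_le (d := k)
    (fun v : T => ({u | G.Adj v u} : Finset V)) fun u => by
      have h1 := card_filter_adj_lt_of_isIndepSet h hTI u
      refine le_trans ?_ (Nat.lt_succ_iff.1 h1)
      refine card_le_card_of_injOn (fun v => (v : V)) (fun v hv => ?_)
        Subtype.val_injective.injOn
      simp only [coe_filter, mem_filter, mem_univ, true_and, Set.mem_ofPred_eq] at hv ⊢
      exact ⟨v.2, hv.symm⟩
  -- Disjoint palettes on S and off S: neither can spoil a colour unique within the other.
  refine Nat.sInf_le ⟨fun u => finSumFinEquiv (if u ∈ S then Sum.inl (c u) else Sum.inr (d u)),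
    fun v => ?_⟩
  by_cases hv : ∃ u ∈ S, G.Adj v u
  · obtain ⟨x, hxS, hvx, hx⟩ := hc v hv
    refine ⟨_, x, ⟨hvx, rfl⟩, fun y ⟨hvy, hy⟩ => ?_⟩
    have hy := finSumFinEquiv.injective hy
    by_cases hyS : y ∈ S
    · simp only [hyS, hxS, if_true, Sum.inl.injEq] at hy
      exact hx y hyS hvy hy
    · simp [hyS, hxS] at hy
  · push Not at hv
    have hvS : v ∈ S := by
      by_contra hvS
      obtain ⟨u, hu⟩ := card_pos.1 (hm0.trans_le (hge v hvS))
      exact hv u (mem_filter.1 hu).1 (mem_filter.1 hu).2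
    have hvT : v ∈ T := mem_filter.2 ⟨hvS, hv⟩
    obtain ⟨w, hw⟩ := hG v
    obtain ⟨x, hvx, hx⟩ := hd ⟨v, hvT⟩ ⟨w, by simpa using hw⟩
    simp only [mem_filter, mem_univ, true_and] at hvx hx
    refine ⟨_, x, ⟨hvx, rfl⟩, fun y ⟨hvy, hy⟩ => ?_⟩
    have hy := finSumFinEquiv.injective hy
    have hxS : x ∉ S := fun hxS => hv x hxS hvx
    have hyS : y ∉ S := fun hyS => hv y hyS hvy
    simp only [hyS, hxS, if_false, Sum.inr.injEq] at hy
    exact hx y hvy hy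

end SimpleGraph

theorem theorem2 :
    ∃ C : ℝ, 0 < C ∧
      ∀ (k : ℕ), 3 ≤ k →
      ∀ (V : Type*) [Fintype V] (G : SimpleGraph V) [DecidableRel G.Adj],
        ¬ (completeBipartiteGraph (Fin 1) (Fin k)).IsIndContained G →
        (∀ v : V, ∃ u : V, G.Adj v u) →
        2 ≤ G.maxDegree →
        (G.cfonChromaticNumber : ℝ) ≤ C * (k : ℝ) ^ 2 * Real.log (G.maxDegree : ℝ) := by
  -- With l = ⌊log₂ Δ⌋ ≥ 1 and m = l + 2 ≤ 3l, the count is at most (64 * 3 + 3) * k * l = 195 * k *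
  -- l, and l ≤ 2 ln Δ because ln 2 > 1/2.
  refine ⟨390, by norm_num, fun k hk V _ G _ hfree hG hΔ => ?_⟩
  obtain ⟨j, rfl⟩ : ∃ j, k = j + 1 := ⟨k - 1, by omega⟩
  set Δ := G.maxDegree with hΔdef
  set l := Nat.log 2 Δ with hl
  have hl1 : 1 ≤ l := Nat.log_pos (by norm_num) hΔ
  have hlt : 2 * Δ ≤ 2 ^ (l + 2) := by
    have := Nat.lt_pow_succ_log_self (b := 2) (by norm_num) Δ
    rw [pow_succ, ← hl.symm] at *
    omega
  have hmain := SimpleGraph.cfonChromaticNumber_le (m := l + 2) (by omega) hfree hG (by omega) hlt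
  have hcol : G.cfonChromaticNumber ≤ 195 * (j + 1) ^ 2 * l := by
    refine hmain.trans ?_
    have h1 : j * (l + 2) ≤ (j + 1) * (3 * l) := Nat.mul_le_mul (by omega) (by omega)
    have h2 : (j + 1) * 1 ≤ (j + 1) * (3 * l) := Nat.mul_le_mul_left _ (by omega)
    have h3 : (j + 1) * l ≤ (j + 1) ^ 2 * l :=
      Nat.mul_le_mul_right _ (Nat.le_self_pow (by norm_num) _)
    nlinarith
  have hlog : (l : ℝ) ≤ 2 * Real.log Δ := by
    have hpow : (2 : ℝ) ^ l ≤ Δ := by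
      exact_mod_cast Nat.pow_log_le_self 2 (by omega : Δ ≠ 0)
    have h1 := Real.log_le_log (by positivity) hpow
    rw [Real.log_pow] at h1
    have h2 := Real.log_two_gt_d9
    have h3 : (0 : ℝ) ≤ l := by positivity
    nlinarith
  calc (G.cfonChromaticNumber : ℝ) ≤ 195 * ((j + 1 : ℕ) : ℝ) ^ 2 * l := by exact_mod_cast hcol
    _ ≤ 195 * ((j + 1 : ℕ) : ℝ) ^ 2 * (2 * Real.log Δ) := by gcongr
    _ = 390 * ((j + 1 : ℕ) : ℝ) ^ 2 * Real.log Δ := by ring
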